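/- Let $\mathcal{A}$ be a finite alphabet, let $\boldsymbol{L}=(L_1,\dots,L_d)$ be a vector of positive integers, and put $R=\prod_{i=1}^d\{0,\dots,L_i-1\}$. Let $\varrho\colon\mathcal{A}\to\mathcal{A}^R$ be a rectangular substitution that is bijective, i.e. for each $\boldsymbol{r}\in R$ the column $a\mapsto\varrho(a)_{\boldsymbol{r}}$ is a bijection of $\mathcal{A}$. Let $\varrho^k(a)$ be the iterated blocks, of shape $\prod_i\{0,\dots,L_i^k-1\}$, given by $\varrho^{0}(a)=a$ and $\varrho^{k+1}(a)_{Q\boldsymbol{m}+\boldsymbol{r}}=\varrho(\varrho^k(a)_{\boldsymbol{m}})_{\boldsymbol{r}}$ for $\boldsymbol{r}\in R$, where $Q=\mathrm{diag}(L_1,\dots,L_d)$. Let $\mathbb{X}_\varrho\subseteq\mathcal{A}^{\mathbb{Z}^d}$ be the set of all configurations each of whose finite patterns is, up to translation, a subpattern of $\varrho^k(a)$ for some $k\geq 1$ and some $a\in\mathcal{A}$. It carries the product topology (with $\mathcal{A}$ discrete) and the shift action $(\sigma_{\boldsymbol{n}}x)_{\boldsymbol{m}}=x_{\boldsymbol{n}+\boldsymbol{m}}$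 of $\mathbb{Z}^d$. Assume that this action is faithful, i.e. $\sigma_{\boldsymbol{n}}\neq\mathrm{id}$ on $\mathbb{X}_\varrho$ for all $\boldsymbol{n}\neq\boldsymbol{0}$. Let $\mathcal{R}(\mathbb{X}_\varrho)$ be the normaliser of the group $\{\sigma_{\boldsymbol{n}}\mid\boldsymbol{n}\in\mathbb{Z}^d\}$ in the group of all self-homeomorphisms of $\mathbb{X}_\varrho$, and let $W_d\leqslant\mathrm{GL}(d,\mathbb{Z})$ be the hyperoctahedral group of signed permutation matrices. **Theorem.** Suppose that for some indices $i,j\in\{1,\dots,d\}$ there is a prime $p$ with $p\mid L_j$ and $p\nmid L_i$. Let $A\in W_d$ be the matrix underlying some $f\in\mathcal{R}(\mathbb{X}_\varrho)$, i.e. $f\circ\sigma_{\boldsymbol{n}}\circ f^{-1}=\sigma_{A\boldsymbol{n}}$ for all $\boldsymbol{n}\in\mathbb{Z}^d$. Then $A_{ij}=A_{ji}=0$. -/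

import Mathlib

open SymbolicDynamics.FullShift

/-- A rectangular substitution `ϱ : 𝒜 → 𝒜^R` in dimension `d`, with support the rectangle
`R = [0, L - 1] = ∏ i, {0, …, L i - 1}`: it sends each letter to a block of shape `R`. -/
def RectangularSubstitution {d : ℕ} (𝒜 : Type*) (L : Fin d → ℕ) : Type _ :=
  𝒜 → ((i : Fin d) → Fin (L i)) → 𝒜

namespace RectangularSubstitution

variable {d : ℕ} {𝒜 : Type*} {L : Fin d → ℕ}

/-- The column `ϱ_r : 𝒜 → 𝒜`, `a ↦ ϱ(a)_r`, at the position `r ∈ R`. -/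
def column (ϱ : RectangularSubstitution 𝒜 L) (r : (i : Fin d) → Fin (L i)) (a : 𝒜) : 𝒜 :=
  ϱ a r

/-- `ϱ` is bijective if each of its columns is a bijection of the alphabet. -/
def IsBijective (ϱ : RectangularSubstitution 𝒜 L) : Prop :=
  ∀ r, Function.Bijective (ϱ.column r)

/-- The iterated block `ϱ^k(a)`, of shape `∏ i, {0, …, (L i)^k - 1}`. One has
`ϱ^(k+1)(a) = ϱ(ϱ^k(a))`, i.e. the letter of `ϱ^(k+1)(a)` at the position `Q m + r`,
with `Q = diag(L)` and `r ∈ R`, is `ϱ(ϱ^k(a)_m)_r`. -/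
def iterate (ϱ : RectangularSubstitution 𝒜 L) :
    (k : ℕ) → 𝒜 → ((i : Fin d) → Fin (L i ^ k)) → 𝒜
  | 0, a, _ => a
  | k + 1, a, n =>
      ϱ (ϱ.iterate k a fun i => Fin.divNat (m := L i ^ k) (n := L i) (n i))
        fun i => Fin.modNat (m := L i ^ k) (n := L i) (n i)

/-- The language of `ϱ`: all finite patterns `P : U → 𝒜`, `U ⊂ ℤ^d`, which up to a translation
by some `t` are subpatterns of `ϱ^k(a)`, for some `k ≥ 1` and some letter `a`. -/
def language (ϱ : RectangularSubstitution 𝒜 L) : Set (Σ U : Finset (Fin d → ℤ), (U → 𝒜)) :=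
  {P | ∃ k : ℕ, 1 ≤ k ∧ ∃ (a : 𝒜) (t : Fin d → ℤ), ∀ u : P.1,
    ∃ n : (i : Fin d) → Fin (L i ^ k),
      (∀ i, ((n i : ℕ) : ℤ) = t i + u.1 i) ∧ ϱ.iterate k a n = P.2 u}

/-- The configurations all of whose finite patterns belong to the language of `ϱ`. -/
def hull (ϱ : RectangularSubstitution 𝒜 L) : Set ((Fin d → ℤ) → 𝒜) :=
  {x | ∀ U : Finset (Fin d → ℤ), (⟨U, fun u => x u⟩ : Σ U : Finset (Fin d → ℤ), (U → 𝒜)) ∈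
    ϱ.language}

theorem isClosed_hull [TopologicalSpace 𝒜] [DiscreteTopology 𝒜]
    (ϱ : RectangularSubstitution 𝒜 L) : IsClosed ϱ.hull := by
  rw [← isOpen_compl_iff, isOpen_iff_forall_mem_open]
  intro x hx
  obtain ⟨U, hU⟩ := not_forall.mp hx
  refine ⟨cylinder U x, ?_, isOpen_cylinder U x, fun i _ => rfl⟩
  intro y hy hyX
  apply hU
  have h : (fun u : U => y u) = fun u : U => x u := funext fun u => hy u.1 u.2
  simpa [h] using hyX U

theorem mapsTo_shift_hull (ϱ : RectangularSubstitution 𝒜 L) (g : Fin d → ℤ) :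
    Set.MapsTo (shift g) ϱ.hull ϱ.hull := by
  intro x hx U
  obtain ⟨k, hk, a, t, h⟩ := hx (U.map (addLeftEmbedding g))
  refine ⟨k, hk, a, t + g, fun u => ?_⟩
  obtain ⟨n, hn, hna⟩ := h ⟨g + u.1, by simp⟩
  refine ⟨n, fun i => ?_, by simpa using hna⟩
  have := hn i
  simp only [Pi.add_apply] at this ⊢
  omega

/-- The substitutive subshift `𝕏_ϱ` defined by `ϱ`. -/
def subshift [TopologicalSpace 𝒜] [DiscreteTopology 𝒜] (ϱ : RectangularSubstitution 𝒜 L) :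
    Subshift 𝒜 (Fin d → ℤ) where
  carrier := ϱ.hull
  isClosed := ϱ.isClosed_hull
  mapsTo := ϱ.mapsTo_shift_hull

end RectangularSubstitution

section Symmetries

variable {d : ℕ} {𝒜 : Type*} [TopologicalSpace 𝒜]

/-- The shift map `σ_n`, `(σ_n x)_m = x_{n+m}`, as a homeomorphism of the subshift. -/
def shiftHomeomorph (X : Subshift 𝒜 (Fin d → ℤ)) (n : Fin d → ℤ) : X.carrier ≃ₜ X.carrier where
  toFun x := ⟨shift n x.1, X.mapsTo n x.2⟩
  invFun x := ⟨shift (-n) x.1, X.mapsTo (-n) x.2⟩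
  left_inv x := by ext m; simp
  right_inv x := by ext m; simp
  continuous_toFun := ((continuous_shift n).comp continuous_subtype_val).subtype_mk _
  continuous_invFun := ((continuous_shift (-n)).comp continuous_subtype_val).subtype_mk _

/-- The shift action of `ℤ^d` on a subshift `X`, as a homomorphism into the group `Aut(X)` of all
self-homeomorphisms of `X` (with composition). -/
def shiftAction (X : Subshift 𝒜 (Fin d → ℤ)) :
    Multiplicative (Fin d → ℤ) →* (X.carrier ≃ₜ X.carrier) where
  toFun n := shiftHomeomorph X n.toAdd
  map_one' := by ext x m; simp [shiftHomeomorph]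
  map_mul' a b := by
    ext x m
    simp [shiftHomeomorph, add_assoc, add_left_comm]

/-- The shift action on `X` is faithful: distinct elements of `ℤ^d` act by distinct maps. -/
def IsFaithfulShift (X : Subshift 𝒜 (Fin d → ℤ)) : Prop :=
  Function.Injective (shiftAction X)

/-- The extended symmetry group `ℛ(X)`: the normaliser in `Aut(X)` of the group generated by
the shifts. -/
def extendedSymmetryGroup (X : Subshift 𝒜 (Fin d → ℤ)) : Subgroup (X.carrier ≃ₜ X.carrier) :=
  Subgroup.normalizer ((shiftAction X).range : Set (X.carrier ≃ₜ X.carrier))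

/-- `A` is an underlying matrix of `f`: one has `f ∘ σ_n ∘ f⁻¹ = σ_{A n}` for all `n ∈ ℤ^d`. -/
def IsUnderlyingMatrix {X : Subshift 𝒜 (Fin d → ℤ)} (f : X.carrier ≃ₜ X.carrier)
    (A : GL (Fin d) ℤ) : Prop :=
  ∀ n : Fin d → ℤ, f * shiftHomeomorph X n * f⁻¹ =
    shiftHomeomorph X ((A : Matrix (Fin d) (Fin d) ℤ).mulVec n)

end Symmetries

/-- The hyperoctahedral group `W_d ≤ GL(d, ℤ)` of signed permutation matrices: there are a
permutation `π` of the coordinates and signs `ε` with `A e_j = ε_j e_{π j}` for all `j`. -/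
def hyperoctahedralGroup (d : ℕ) : Subgroup (GL (Fin d) ℤ) where
  carrier := {A | ∃ (π : Equiv.Perm (Fin d)) (ε : Fin d → ℤˣ), ∀ i j,
    (A : Matrix (Fin d) (Fin d) ℤ) i j = if i = π j then (ε j : ℤ) else 0}
  one_mem' := ⟨1, 1, fun i j => by by_cases h : i = j <;> simp [h]⟩
  mul_mem' := by
    rintro A B ⟨π, ε, hA⟩ ⟨ρ, δ, hB⟩
    refine ⟨π * ρ, fun j => ε (ρ j) * δ j, fun i j => ?_⟩
    rw [Units.val_mul, Matrix.mul_apply, Finset.sum_eq_single (ρ j)]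
    · by_cases h : i = π (ρ j) <;> simp [hA, hB, h]
    · intro k _ hk
      simp [hB, hk]
    · simp
  inv_mem' := by
    rintro A ⟨π, ε, hA⟩
    let B : Matrix (Fin d) (Fin d) ℤ :=
      Matrix.of fun i j => if i = π⁻¹ j then (ε (π⁻¹ j) : ℤ) else 0
    have hAB : (A : Matrix (Fin d) (Fin d) ℤ) * B = 1 := by
      ext i j
      rw [Matrix.mul_apply, Finset.sum_eq_single (π⁻¹ j)]
      · by_cases h : i = j
        · subst h
          simp [hA, B]
        · simp [hA, B, h]
      · intro k _ hk
        simp only [B, Matrix.of_apply, if_neg hk, mul_zero]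
      · simp
    have hB : ((A⁻¹ : GL (Fin d) ℤ) : Matrix (Fin d) (Fin d) ℤ) = B := by
      calc ((A⁻¹ : GL (Fin d) ℤ) : Matrix (Fin d) (Fin d) ℤ)
          = ((A⁻¹ : GL (Fin d) ℤ) : Matrix (Fin d) (Fin d) ℤ) *
              ((A : Matrix (Fin d) (Fin d) ℤ) * B) := by rw [hAB, mul_one]
        _ = B := by rw [← mul_assoc, ← Units.val_mul, inv_mul_cancel, Units.val_one, one_mul]
    exact ⟨π⁻¹, fun j => ε (π⁻¹ j), fun i j => by rw [hB]; rfl⟩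

/-! If `A i j ≠ 0`, then `f` carries the shifts along `e_j` to those along `±e_i`; if `A j i ≠ 0`,
then `f⁻¹` does. The contradiction comes from recurrence in direction `i`, seen in direction `j`.

Take `k` with `p ^ k > |𝒜|`. Among `p ^ k` consecutive letters along `e_i` two agree; inflating them
`l` times gives large windows on which a configuration agrees with its translate by `D e_i`, where
`D = L_i^l (t' - t)` is not divisible by `p ^ k`, since `p ∤ L_i` (`exists_almost_return`). Hence
configurations `y_ρ` and their translates converge to the same `z`. Under the conjugacy the
preimages of `y_ρ` are translated by `±D e_j`. As `p ^ k ∣ L_j ^ k`, this moves the level-`k`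
supertiles out of phase, so the limit `f⁻¹ z` carries two level-`k` structures with different phases
along `e_j` (`isClosed_phaseShifted`).

For a bijective substitution two such structures force a fixed period `P` along `e_j`
(`inflate_iterate_periodic`), so `z` has period `P` along `e_i`. By faithfulness some configuration
lacks this period, and the failure can be put at the centre of every window
(`HasViolation.exists_deep`), so it survives in `z`. -/

namespace RectangularSubstitution

variable {d : ℕ} {𝒜 : Type*} {L : Fin d → ℕ}

/-! ### Supertile coordinates on `ℤ^d`. -/

/-- The position `Q^k m`, with `Q = diag(L)`. -/
def scale (L : Fin d → ℕ) (k : ℕ) (m : Fin d → ℤ) : Fin d → ℤ :=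
  fun h => (L h : ℤ) ^ k * m h

/-- The position of the level-`k` supertile that contains the position `n`. -/
def coarse (L : Fin d → ℕ) (k : ℕ) (n : Fin d → ℤ) : Fin d → ℤ :=
  fun h => n h / (L h : ℤ) ^ k

theorem scale_add (k : ℕ) (m n : Fin d → ℤ) :
    scale L k (m + n) = scale L k m + scale L k n := by
  ext h
  simp [scale, mul_add]

theorem scale_zero_right (k : ℕ) : scale L k 0 = 0 := by
  ext h
  simp [scale]

theorem scale_zero_left (m : Fin d → ℤ) : scale L 0 m = m := by
  ext h
  simp [scale]

theorem scale_single (k : ℕ) (j : Fin d) (c : ℤ) :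
    scale L k (Pi.single j c) = Pi.single j ((L j : ℤ) ^ k * c) := by
  ext h
  by_cases hj : h = j
  · subst hj
    simp [scale]
  · simp [scale, hj]

theorem coarse_scale_add (hL : ∀ h, 0 < L h) (k : ℕ) (m n : Fin d → ℤ) :
    coarse L k (scale L k m + n) = m + coarse L k n := by
  ext h
  have : (L h : ℤ) ^ k ≠ 0 := pow_ne_zero _ (by exact_mod_cast (hL h).ne')
  simp [coarse, scale, Int.add_comm, Int.add_mul_ediv_left _ _ this]

theorem coarse_coarse (k l : ℕ) (n : Fin d → ℤ) :
    coarse L k (coarse L l n) = coarse L (k + l) n := by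
  ext h
  simp [coarse, Int.ediv_ediv_of_nonneg (pow_nonneg (Int.natCast_nonneg (L h)) l), pow_add,
    mul_comm]

theorem coarse_eq_zero {k : ℕ} {n : Fin d → ℤ}
    (hn : ∀ h, 0 ≤ n h ∧ n h < (L h : ℤ) ^ k) : coarse L k n = 0 :=
  funext fun h => Int.ediv_eq_zero_of_lt (hn h).1 (hn h).2

theorem coarse_zero (n : Fin d → ℤ) : coarse L 0 n = n := by
  ext h
  simp [coarse]

theorem exists_eq_scale_add (hL : ∀ h, 0 < L h) (k : ℕ) (t : Fin d → ℤ) :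
    ∃ (m : Fin d → ℤ) (r : (h : Fin d) → Fin (L h ^ k)),
      t = scale L k m + fun h => ((r h : ℕ) : ℤ) := by
  have hpos (h : Fin d) : (0 : ℤ) < (L h : ℤ) ^ k := pow_pos (by exact_mod_cast hL h) k
  refine ⟨coarse L k t, fun h => ⟨(t h % (L h : ℤ) ^ k).toNat, ?_⟩, ?_⟩
  · have h1 := Int.emod_nonneg (t h) (hpos h).ne'
    have h2 := Int.emod_lt_of_pos (t h) (hpos h)
    zify
    rw [Int.toNat_of_nonneg h1]
    exact h2
  · ext h
    have h1 := Int.emod_nonneg (t h) (hpos h).ne'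
    simp only [Pi.add_apply, scale, coarse]
    rw [Int.toNat_of_nonneg h1]
    exact (Int.mul_ediv_add_emod _ _).symm

/-- The residue of a position modulo `L`, as an element of the rectangle `R`. -/
def residue (hL : ∀ h, 0 < L h) (n : Fin d → ℤ) : (h : Fin d) → Fin (L h) := fun h =>
  ⟨(n h % (L h : ℤ)).toNat, by
    have hpos : (0 : ℤ) < L h := by exact_mod_cast hL h
    have h1 := Int.emod_nonneg (n h) hpos.ne'
    have h2 := Int.emod_lt_of_pos (n h) hpos
    omega⟩

/-! ### Inflation of configurations. -/

/-- The action of the substitution on configurations, `(ϱ x)_(Q m + r) = ϱ(x_m)_r`. -/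
def inflate (ϱ : RectangularSubstitution 𝒜 L) (hL : ∀ h, 0 < L h) (x : (Fin d → ℤ) → 𝒜) :
    (Fin d → ℤ) → 𝒜 :=
  fun n => ϱ (x (coarse L 1 n)) (residue hL n)

variable (ϱ : RectangularSubstitution 𝒜 L) (hL : ∀ h, 0 < L h)

theorem inflate_iterate_eq_iterate (k : ℕ) (x : (Fin d → ℤ) → 𝒜) (m : Fin d → ℤ)
    (n : (h : Fin d) → Fin (L h ^ k)) :
    (ϱ.inflate hL)^[k] x (scale L k m + fun h => ((n h : ℕ) : ℤ)) = ϱ.iterate k (x m) n := by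
  induction k with
  | zero =>
    have : (scale L 0 m + fun h => ((n h : ℕ) : ℤ)) = m := by
      ext h
      have : (n h : ℕ) < 1 := (n h).2.trans_eq (pow_zero _)
      simp only [scale, Pi.add_apply, pow_zero, one_mul]
      omega
    simp [iterate, this]
  | succ k ih =>
    rw [Function.iterate_succ_apply']
    have h1 : coarse L 1 (scale L (k + 1) m + fun h => ((n h : ℕ) : ℤ)) = scale L k m +
        fun h => ((Fin.divNat (m := L h ^ k) (n := L h) (n h) : ℕ) : ℤ) := by
      ext h
      have : (L h : ℤ) ≠ 0 := by exact_mod_cast (hL h).ne'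
      change ((L h : ℤ) ^ (k + 1) * m h + ((n h : ℕ) : ℤ)) / (L h : ℤ) ^ 1 =
        (L h : ℤ) ^ k * m h + (((n h : ℕ) / L h : ℕ) : ℤ)
      rw [pow_one, pow_succ', mul_assoc, Int.add_comm, Int.add_mul_ediv_left _ _ this, add_comm]
      push_cast
      rfl
    have h2 : residue hL (scale L (k + 1) m + fun h => ((n h : ℕ) : ℤ)) =
        fun h => Fin.modNat (m := L h ^ k) (n := L h) (n h) := by
      ext h
      simp only [residue, scale, Pi.add_apply, pow_succ', mul_assoc, Int.mul_add_emod_self_left]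
      simp [Fin.modNat]
      norm_cast
    simp only [inflate, iterate]
    rw [h1, h2, ih]

/-- This is how bijectivity is used: `g` is a composition of columns and depends only on `k` and the
offset `n`, not on `x` or on the supertile `m`. -/
theorem exists_perm_inflate_iterate (hbij : ϱ.IsBijective) (k : ℕ) (n : Fin d → ℤ) :
    ∃ g : Equiv.Perm 𝒜, ∀ x m,
      (ϱ.inflate hL)^[k] x (scale L k m + n) = g (x (m + coarse L k n)) := by
  induction k generalizing n with
  | zero =>
    refine ⟨1, fun x m => ?_⟩
    rw [coarse_zero, scale_zero_left]
    rfl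
  | succ k ih =>
    obtain ⟨g, hg⟩ := ih (coarse L 1 n)
    refine ⟨g.trans (Equiv.ofBijective _ (hbij (residue hL n))), fun x m => ?_⟩
    have h1 : scale L (k + 1) m + n = scale L 1 (scale L k m) + n := by
      ext h
      simp [scale, pow_succ', mul_assoc]
    have h2 : residue hL (scale L (k + 1) m + n) = residue hL n := by
      ext h
      simp [residue, scale, pow_succ', mul_assoc, Int.mul_add_emod_self_left]
    rw [Function.iterate_succ_apply']
    simp only [inflate]
    rw [h2, h1, coarse_scale_add hL, hg, coarse_coarse]
    rfl

theorem exists_perm_inflate_iterate_apply (hbij : ϱ.IsBijective) (k : ℕ) (n : Fin d → ℤ) :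
    ∃ g : Equiv.Perm 𝒜, ∀ x, (ϱ.inflate hL)^[k] x n = g (x (coarse L k n)) := by
  obtain ⟨g, hg⟩ := ϱ.exists_perm_inflate_iterate hL hbij k n
  refine ⟨g, fun x => ?_⟩
  simpa [scale_zero_right] using hg x 0

theorem inflate_iterate_shift (k : ℕ) (x : (Fin d → ℤ) → 𝒜) (m : Fin d → ℤ) :
    (ϱ.inflate hL)^[k] (shift m x) = shift (scale L k m) ((ϱ.inflate hL)^[k] x) := by
  ext n
  obtain ⟨q, r, rfl⟩ := exists_eq_scale_add hL k n
  rw [inflate_iterate_eq_iterate, shift_apply, shift_apply, ← add_assoc, ← scale_add,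
    inflate_iterate_eq_iterate]

theorem continuous_inflate_iterate [TopologicalSpace 𝒜] [DiscreteTopology 𝒜] (k : ℕ) :
    Continuous (ϱ.inflate hL)^[k] := by
  refine Continuous.iterate (continuous_pi fun n => ?_) k
  exact (continuous_of_discreteTopology (f := fun a => ϱ a (residue hL n))).comp
    (continuous_apply _)

/-! ### The hull and its supertile structure. -/

theorem mem_hull_iff (x : (Fin d → ℤ) → 𝒜) :
    x ∈ ϱ.hull ↔ ∀ U : Finset (Fin d → ℤ), ∃ k, 1 ≤ k ∧ ∃ (a : 𝒜) (t : Fin d → ℤ), ∀ u ∈ U,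
      (∀ h, 0 ≤ t h + u h ∧ t h + u h < (L h : ℤ) ^ k) ∧
        x u = (ϱ.inflate hL)^[k] (fun _ => a) (t + u) := by
  have key (k : ℕ) (a : 𝒜) (n : (h : Fin d) → Fin (L h ^ k)) :
      (ϱ.inflate hL)^[k] (fun _ => a) (fun h => ((n h : ℕ) : ℤ)) = ϱ.iterate k a n := by
    rw [← ϱ.inflate_iterate_eq_iterate hL k (fun _ => a) 0 n]
    rw [scale_zero_right, zero_add]
  refine forall_congr' fun U => exists_congr fun k => and_congr_right fun _ =>
    exists_congr fun a => exists_congr fun t => ⟨fun H u hu => ?_, fun H u => ?_⟩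
  · obtain ⟨n, hn, hna⟩ := H ⟨u, hu⟩
    have htu : t + u = fun h => ((n h : ℕ) : ℤ) := funext fun h => (hn h).symm
    refine ⟨fun h => ?_, ?_⟩
    · rw [← hn h]
      exact ⟨by positivity, by exact_mod_cast (n h).2⟩
    · rw [htu, key, hna]
  · obtain ⟨hb, hx⟩ := H u.1 u.2
    have hlt (h : Fin d) : (t h + u.1 h).toNat < L h ^ k := by
      have := (hb h).2
      zify
      rwa [Int.toNat_of_nonneg (hb h).1]
    refine ⟨fun h => ⟨(t h + u.1 h).toNat, hlt h⟩, fun h => Int.toNat_of_nonneg (hb h).1, ?_⟩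
    rw [← key]
    change _ = x u.1
    rw [hx]
    exact congrArg _ <| funext fun h => Int.toNat_of_nonneg (hb h).1

theorem inflate_mem_hull {x : (Fin d → ℤ) → 𝒜} (hx : x ∈ ϱ.hull) : ϱ.inflate hL x ∈ ϱ.hull := by
  classical
  rw [ϱ.mem_hull_iff hL] at hx ⊢
  intro U
  obtain ⟨k, hk, a, t, H⟩ := hx (U.image (coarse L 1))
  refine ⟨k + 1, by omega, a, scale L 1 t, fun u hu => ?_⟩
  obtain ⟨hb, hxu⟩ := H _ (Finset.mem_image_of_mem _ hu)
  refine ⟨fun h => ?_, ?_⟩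
  · have hpos : (0 : ℤ) < L h := by exact_mod_cast hL h
    obtain ⟨h1, h2⟩ := hb h
    simp only [coarse, scale, pow_one] at h1 h2 ⊢
    have e1 := Int.mul_ediv_add_emod (u h) (L h)
    have e2 := Int.emod_nonneg (u h) hpos.ne'
    have e3 := Int.emod_lt_of_pos (u h) hpos
    have e4 : (L h : ℤ) * t h + u h = L h * (t h + u h / L h) + u h % L h := by
      rw [mul_add]
      omega
    rw [e4, pow_succ']
    refine ⟨by positivity, ?_⟩
    have := mul_le_mul_of_nonneg_left (Int.add_one_le_of_lt h2) hpos.le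
    rw [mul_add] at this
    omega
  · rw [Function.iterate_succ_apply']
    have : residue hL (scale L 1 t + u) = residue hL u := by
      ext h
      simp [residue, scale, Int.mul_add_emod_self_left]
    simp only [inflate]
    rw [this, coarse_scale_add hL, hxu]

theorem inflate_iterate_mem_hull {x : (Fin d → ℤ) → 𝒜} (hx : x ∈ ϱ.hull) (k : ℕ) :
    (ϱ.inflate hL)^[k] x ∈ ϱ.hull := by
  induction k with
  | zero => exact hx
  | succ k ih =>
    rw [Function.iterate_succ_apply']
    exact ϱ.inflate_mem_hull hL ih

/-- Every element of the hull has a level-`k` supertile structure. -/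
theorem exists_eq_shift_inflate_iterate [Finite 𝒜] [TopologicalSpace 𝒜] [DiscreteTopology 𝒜]
    (i : Fin d) {x : (Fin d → ℤ) → 𝒜} (hx : x ∈ ϱ.hull) (k : ℕ) :
    ∃ (r : (h : Fin d) → Fin (L h ^ k)) (v : (Fin d → ℤ) → 𝒜),
      x = shift (fun h => ((r h : ℕ) : ℤ)) ((ϱ.inflate hL)^[k] v) := by
  classical
  let K : Set ((Fin d → ℤ) → 𝒜) := ⋃ r : (h : Fin d) → Fin (L h ^ k),
    Set.range fun v => shift (fun h => ((r h : ℕ) : ℤ)) ((ϱ.inflate hL)^[k] v)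
  have hK : IsClosed K := isClosed_iUnion_of_finite fun r =>
    (isCompact_range ((continuous_shift _).comp (ϱ.continuous_inflate_iterate hL k))).isClosed
  suffices hxK : x ∈ K by
    obtain ⟨r, v, h⟩ := Set.mem_iUnion.mp hxK
    exact ⟨r, v, h.symm⟩
  by_contra hxK
  obtain ⟨U, u, hU, hUK⟩ := isOpen_pi_iff.mp hK.isOpen_compl x hxK
  -- The two extra points are `L_i ^ k` apart, so a block containing both has level at least `k`.
  obtain ⟨l, -, a, t, H⟩ := (ϱ.mem_hull_iff hL x).mp hx
    (U ∪ {0, Pi.single i ((L i : ℤ) ^ k)})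
  have hkl : k ≤ l := by
    by_contra hlt
    have h1 := (H 0 (by simp)).1 i
    have h2 := (H (Pi.single i ((L i : ℤ) ^ k)) (by simp)).1 i
    have h3 : L i ^ l ≤ L i ^ k := Nat.pow_le_pow_right (hL i) (by omega)
    zify at h3
    simp only [Pi.zero_apply, Pi.single_eq_same] at h1 h2
    omega
  obtain ⟨m, r, ht⟩ := exists_eq_scale_add hL k t
  let v := shift m ((ϱ.inflate hL)^[l - k] fun _ => a)
  let y := shift (fun h => ((r h : ℕ) : ℤ)) ((ϱ.inflate hL)^[k] v)
  have hy : y = shift t ((ϱ.inflate hL)^[l] fun _ => a) := by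
    simp only [y, v]
    rw [inflate_iterate_shift, ← shift_add, ← ht, ← Function.iterate_add_apply,
      Nat.add_sub_cancel' hkl]
  refine hUK (a := y) (fun n hn => ?_) (Set.mem_iUnion.mpr ⟨r, v, rfl⟩)
  have hyx : y n = x n := by
    rw [hy, (H n (by simp [Finset.mem_coe.mp hn])).2]
    rfl
  rw [hyx]
  exact (hU n hn).2

end RectangularSubstitution

/-! ### Out-of-phase supertiles force periodicity; propagation of violations of periodicity. -/

namespace RectangularSubstitution

variable {d : ℕ} {𝒜 : Type*} {L : Fin d → ℕ} (ϱ : RectangularSubstitution 𝒜 L)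
  (hL : ∀ h, 0 < L h)

/-- A configuration with two level-`k` supertile structures that differ in direction `j` is
periodic in that direction. -/
theorem inflate_iterate_periodic [Finite 𝒜] (hbij : ϱ.IsBijective) (j : Fin d) (k : ℕ) (D : ℤ)
    (hD : ¬ (L j : ℤ) ^ k ∣ D) (v v' : (Fin d → ℤ) → 𝒜)
    (h : (ϱ.inflate hL)^[k] v = shift (Pi.single j D) ((ϱ.inflate hL)^[k] v')) :
    shift (Pi.single j ((L j : ℤ) ^ k * Nat.card (Equiv.Perm 𝒜))) ((ϱ.inflate hL)^[k] v) =
      (ϱ.inflate hL)^[k] v := by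
  have hq : (0 : ℤ) < (L j : ℤ) ^ k := pow_pos (by exact_mod_cast hL j) k
  set q : ℤ := (L j : ℤ) ^ k with hqdef
  obtain ⟨φ, hφ⟩ := ϱ.exists_perm_inflate_iterate hL hbij k (Pi.single j (-1))
  obtain ⟨ψ, hψ⟩ := ϱ.exists_perm_inflate_iterate hL hbij k 0
  obtain ⟨α, hα⟩ := ϱ.exists_perm_inflate_iterate hL hbij k (Pi.single j (D - 1))
  obtain ⟨β, hβ⟩ := ϱ.exists_perm_inflate_iterate hL hbij k (Pi.single j D)
  have coarse_single (c : ℤ) :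
      coarse L k (Pi.single j c : Fin d → ℤ) = Pi.single j (c / q) := by
    ext h
    by_cases hj : h = j
    · subst hj
      simp [coarse, q]
    · simp [coarse, hj]
  -- Offsets `-1` and `0` lie on two sides of a boundary between supertiles of `v`, while `D - 1`
  -- and `D` lie in one supertile of `v'`, because `q ∤ D`.
  have h1 : (-1 : ℤ) / q = -1 := by
    rw [Int.ediv_eq_iff_of_pos hq]
    omega
  have h2 : (D - 1) / q = D / q := by
    rw [Int.ediv_eq_iff_of_pos hq]
    have e1 := Int.mul_ediv_add_emod D q
    have e2 := Int.emod_nonneg D hq.ne'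
    have e3 := Int.emod_lt_of_pos D hq
    have e4 : D % q ≠ 0 := fun h0 => hD (Int.dvd_of_emod_eq_zero h0)
    rw [mul_comm] at e1
    constructor <;> omega
  have e0 : coarse L k (0 : Fin d → ℤ) = 0 := by
    ext h
    simp [coarse]
  -- Neighbouring letters of `v` are determined by the same letter of `v'`; eliminating it leaves a
  -- permutation independent of `m`.
  have step (m : Fin d → ℤ) :
      v m = (φ.trans (α.symm.trans (β.trans ψ.symm))) (v (m + Pi.single j (-1))) := by
    have a1 := hφ v m
    have a2 := hψ v m
    have a3 := hα v' m
    have a4 := hβ v' m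
    rw [coarse_single, h1] at a1
    rw [e0, add_zero, add_zero] at a2
    rw [coarse_single, h2] at a3
    rw [coarse_single] at a4
    have b1 : φ (v (m + Pi.single j (-1))) = α (v' (m + Pi.single j (D / q))) := by
      rw [← a1, ← a3, h, shift_apply]
      rw [add_left_comm, ← Pi.single_add]
      ring_nf
    have b2 : ψ (v m) = β (v' (m + Pi.single j (D / q))) := by
      rw [← a2, ← a4, h, shift_apply, add_comm]
    simp [b1, ← b2]
  generalize φ.trans (α.symm.trans (β.trans ψ.symm)) = τ at step
  have iter (n : ℕ) (m : Fin d → ℤ) : v (m + Pi.single j (n : ℤ)) = (τ ^ n) (v m) := by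
    induction n with
    | zero => simp
    | succ n ih =>
      rw [step, add_assoc, ← Pi.single_add, pow_succ', Equiv.Perm.mul_apply, ← ih]
      simp
  have hv : shift (Pi.single j (Nat.card (Equiv.Perm 𝒜) : ℤ)) v = v := by
    ext m
    rw [shift_apply, add_comm, iter, pow_card_eq_one', Equiv.Perm.one_apply]
  rw [hqdef, ← scale_single, ← inflate_iterate_shift, hv]

/-- The letter `a` has an iterated block that is not `P`-periodic in direction `i`. -/
def HasViolation (i : Fin d) (P : ℤ) (a : 𝒜) : Prop :=
  ∃ (l : ℕ) (n : Fin d → ℤ), coarse L l n = 0 ∧ coarse L l (n + Pi.single i P) = 0 ∧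
    (ϱ.inflate hL)^[l] (fun _ => a) n ≠ (ϱ.inflate hL)^[l] (fun _ => a) (n + Pi.single i P)

variable {ϱ hL}

theorem inflate_iterate_apply_congr (hbij : ϱ.IsBijective) {k : ℕ} {n : Fin d → ℤ}
    {x y : (Fin d → ℤ) → 𝒜} (h : x (coarse L k n) = y (coarse L k n)) :
    (ϱ.inflate hL)^[k] x n = (ϱ.inflate hL)^[k] y n := by
  obtain ⟨g, hg⟩ := ϱ.exists_perm_inflate_iterate_apply hL hbij k n
  rw [hg, hg, h]

/-- The level-`l` block of `ϱ_r(a)` sits inside the level-`(l + 1)` block of `a`, at offset `Q^l r`.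
-/
theorem HasViolation.of_column (hbij : ϱ.IsBijective) {i : Fin d} {P : ℤ} {a : 𝒜}
    {r : (h : Fin d) → Fin (L h)} (h : ϱ.HasViolation hL i P (ϱ.column r a)) :
    ϱ.HasViolation hL i P a := by
  obtain ⟨l, n, h1, h2, h3⟩ := h
  let q : Fin d → ℤ := fun h => ((r h : ℕ) : ℤ)
  have hq : coarse L 1 q = 0 := coarse_eq_zero fun h => ⟨by positivity, by simp [q]⟩
  have hres : residue hL q = r := by
    ext h
    simp only [residue, q]
    rw [Int.emod_eq_of_lt (by positivity) (by simp)]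
    simp
  have hc (m : Fin d → ℤ) (hm : coarse L l m = 0) :
      coarse L (l + 1) (scale L l q + m) = 0 := by
    rw [add_comm l, ← coarse_coarse, coarse_scale_add hL, hm, add_zero, hq]
  have hval (m : Fin d → ℤ) (hm : coarse L l m = 0) :
      (ϱ.inflate hL)^[l + 1] (fun _ => a) (scale L l q + m) =
        (ϱ.inflate hL)^[l] (fun _ => ϱ.column r a) m := by
    obtain ⟨g, hg⟩ := ϱ.exists_perm_inflate_iterate hL hbij l m
    have := hg (fun _ => ϱ.column r a) 0
    rw [scale_zero_right, zero_add] at this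
    rw [Function.iterate_succ_apply, hg, this, hm, add_zero]
    simp [inflate, hres, column]
  refine ⟨l + 1, scale L l q + n, hc n h1, ?_, ?_⟩
  · rw [add_assoc]
    exact hc _ h2
  · rw [add_assoc, hval n h1, hval _ h2]
    exact h3

/-- The column has finite order in the symmetric group, so `a` is reached from `ϱ_r(a)` by further
applications of it, and `HasViolation.of_column` pulls the violation back. -/
theorem HasViolation.column [Finite 𝒜] (hbij : ϱ.IsBijective) {i : Fin d} {P : ℤ} {a : 𝒜}
    (h : ϱ.HasViolation hL i P a) (r : (h : Fin d) → Fin (L h)) :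
    ϱ.HasViolation hL i P (ϱ.column r a) := by
  let g : Equiv.Perm 𝒜 := Equiv.ofBijective _ (hbij r)
  have key (n : ℕ) (b : 𝒜) (hb : ϱ.HasViolation hL i P ((g ^ n) b)) :
      ϱ.HasViolation hL i P b := by
    induction n with
    | zero => exact hb
    | succ n ih =>
      rw [pow_succ', Equiv.Perm.mul_apply] at hb
      exact ih (HasViolation.of_column hbij (r := r) hb)
  have hpos : 0 < Nat.card (Equiv.Perm 𝒜) := Nat.card_pos
  refine key (Nat.card (Equiv.Perm 𝒜) - 1) _ ?_
  have : (g ^ (Nat.card (Equiv.Perm 𝒜) - 1)) (ϱ.column r a) = a := by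
    change (g ^ (Nat.card (Equiv.Perm 𝒜) - 1)) (g a) = a
    rw [← Equiv.Perm.mul_apply, ← pow_succ, Nat.sub_add_cancel hpos, pow_card_eq_one',
      Equiv.Perm.one_apply]
  rwa [this]

theorem HasViolation.inflate_iterate [Finite 𝒜] (hbij : ϱ.IsBijective) {i : Fin d} {P : ℤ}
    {a : 𝒜} (h : ϱ.HasViolation hL i P a) (k : ℕ) (n : Fin d → ℤ) :
    ϱ.HasViolation hL i P ((ϱ.inflate hL)^[k] (fun _ => a) n) := by
  induction k generalizing n with
  | zero => exact h
  | succ k ih =>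
    rw [Function.iterate_succ_apply']
    exact (ih _).column hbij _

theorem exists_ne_succ {α : Type*} (u : ℕ → α) {N : ℕ} (h : u 0 ≠ u N) :
    ∃ t < N, u t ≠ u (t + 1) := by
  by_contra! H
  have key (t : ℕ) (ht : t ≤ N) : u 0 = u t := by
    induction t with
    | zero => rfl
    | succ t ih => rw [ih (by omega), H t (by omega)]
  exact h (key N le_rfl)

/-- Violations of periodicity occur arbitrarily deep inside the iterated blocks. -/
theorem HasViolation.exists_deep (hbij : ϱ.IsBijective) (hL2 : ∀ h, 2 ≤ L h) {i : Fin d} {P : ℤ}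
    (hP : 0 < P) {a : 𝒜} (h : ϱ.HasViolation hL i P a) (ρ : ℕ) :
    ∃ (l : ℕ) (s : Fin d → ℤ), (∀ b : Fin d → ℤ, (∀ h, |b h| ≤ ρ) → coarse L l (s + b) = 0) ∧
      coarse L l (s + Pi.single i P) = 0 ∧
      (ϱ.inflate hL)^[l] (fun _ => a) s ≠ (ϱ.inflate hL)^[l] (fun _ => a) (s + Pi.single i P) := by
  obtain ⟨l, n, h1, h2, h3⟩ := h
  obtain ⟨m, hm⟩ : ∃ m : ℕ, 2 * ρ + P.toNat < 2 ^ m := ⟨_, Nat.lt_two_pow_self⟩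
  have hm' (h : Fin d) : 2 * (ρ : ℤ) + P < (L h : ℤ) ^ m := by
    have : 2 ^ m ≤ L h ^ m := Nat.pow_le_pow_left (hL2 h) m
    zify at this hm
    rw [Int.toNat_of_nonneg hP.le] at hm
    omega
  let q : Fin d → ℤ := fun _ => ρ
  have hq : coarse L m q = 0 := coarse_eq_zero fun h => ⟨by positivity, by
    have := hm' h
    simp only [q]
    omega⟩
  -- Walk in steps of `P` from the supertile at `n` to the one at `n + P e_i`, between points at the
  -- same offset `q`. The end letters differ, hence so do two consecutive ones; the offset `ρ`
  -- provides the margin.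
  let u : ℕ → 𝒜 := fun t => (ϱ.inflate hL)^[m + l] (fun _ => a)
    (scale L m n + q + Pi.single i (P * t))
  obtain ⟨g, hg⟩ := ϱ.exists_perm_inflate_iterate hL hbij m q
  have hu : u 0 ≠ u (L i ^ m) := by
    have e : scale L m n + q + Pi.single i (P * ((L i ^ m : ℕ) : ℤ)) =
        scale L m (n + Pi.single i P) + q := by
      rw [scale_add, scale_single, add_right_comm]
      push_cast
      rw [mul_comm P]
    simp only [u, e]
    simp only [Nat.cast_zero, mul_zero, Pi.single_zero, add_zero]
    rw [Function.iterate_add_apply, hg, hg, hq, add_zero, add_zero]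
    exact g.injective.ne h3
  obtain ⟨t, ht, htu⟩ := exists_ne_succ u hu
  have ht' : P * t + P ≤ P * (L i : ℤ) ^ m := by
    have : (t : ℤ) + 1 ≤ (L i : ℤ) ^ m := by exact_mod_cast ht
    calc P * t + P = P * (t + 1) := by ring
      _ ≤ _ := mul_le_mul_of_nonneg_left this hP.le
  -- Along `e_i` the supertile index stays between `n i` and `n i + P`, which both belong to the
  -- level-`l` block.
  have hbox (b : Fin d → ℤ) (hb : ∀ h, |b h| ≤ ρ) (c : ℤ) (hc0 : 0 ≤ c)
      (hc : c + b i ≤ P * (L i : ℤ) ^ m + ρ) :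
      coarse L (l + m) (scale L m n + q + Pi.single i c + b) = 0 := by
    have hL' (h : Fin d) (k : ℕ) : (0 : ℤ) < (L h : ℤ) ^ k :=
      pow_pos (by exact_mod_cast hL h) k
    rw [← coarse_coarse, add_assoc, add_assoc, coarse_scale_add hL]
    ext h
    have hbh := abs_le.mp (hb h)
    have hmh := hm' h
    have h1' : n h / (L h : ℤ) ^ l = 0 := congrFun h1 h
    change (n h + (ρ + ((Pi.single i c : Fin d → ℤ) h + b h)) / (L h : ℤ) ^ m) /
      (L h : ℤ) ^ l = 0
    by_cases hi : h = i
    · subst hi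
      have h2' : (n h + (Pi.single h P : Fin d → ℤ) h) / (L h : ℤ) ^ l = 0 := congrFun h2 h
      rw [Pi.single_eq_same] at h2' ⊢
      have e1 : 0 ≤ (ρ + (c + b h)) / (L h : ℤ) ^ m :=
        Int.ediv_nonneg (by omega) (hL' h m).le
      have e2 : (ρ + (c + b h)) / (L h : ℤ) ^ m ≤ P :=
        Int.le_of_lt_add_one <| Int.ediv_lt_of_lt_mul (hL' h m) <| by
          rw [add_mul, one_mul]
          omega
      apply le_antisymm
      · rw [← h2']
        exact Int.ediv_le_ediv (hL' h l) (by omega)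
      · rw [← h1']
        exact Int.ediv_le_ediv (hL' h l) (by omega)
    · rw [Pi.single_eq_of_ne hi, zero_add,
        Int.ediv_eq_zero_of_lt (a := ρ + b h) (by omega) (by omega), add_zero, h1']
  refine ⟨m + l, scale L m n + q + Pi.single i (P * t), fun b hb => ?_, ?_, ?_⟩
  · rw [add_comm m l]
    exact hbox b hb _ (by positivity) (by have := abs_le.mp (hb i); omega)
  · rw [add_comm m l, add_assoc, ← Pi.single_add]
    simpa using hbox 0 (by simp) (P * t + P) (by positivity) (by
      rw [Pi.zero_apply]
      omega)
  · simpa [u, add_assoc, ← Pi.single_add, mul_add] using htu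

end RectangularSubstitution

/-! ### Almost returns and phase-shifted pairs. -/

namespace RectangularSubstitution

variable {d : ℕ} {𝒜 : Type*} {L : Fin d → ℕ} {ϱ : RectangularSubstitution 𝒜 L}
  {hL : ∀ h, 0 < L h}

/-- A failure of periodicity and the position `m` fit into a common block of some letter `a`; `a`
has a violation, and passes it on to every letter of its blocks. -/
theorem hasViolation_of_mem_hull [Finite 𝒜] (hbij : ϱ.IsBijective) {i : Fin d} {P : ℤ}
    {x : (Fin d → ℤ) → 𝒜} (hx : x ∈ ϱ.hull) (hne : shift (Pi.single i P) x ≠ x)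
    (m : Fin d → ℤ) : ϱ.HasViolation hL i P (x m) := by
  classical
  obtain ⟨n, hn⟩ := Function.ne_iff.mp hne
  rw [shift_apply, add_comm] at hn
  obtain ⟨k, -, a, s, H⟩ := (ϱ.mem_hull_iff hL x).mp hx
    {n, n + Pi.single i P, m}
  obtain ⟨h1, e1⟩ := H n (by simp)
  obtain ⟨h2, e2⟩ := H (n + Pi.single i P) (by simp)
  have ha : ϱ.HasViolation hL i P a := by
    refine ⟨k, s + n, coarse_eq_zero h1, ?_, ?_⟩
    · rw [add_assoc]
      exact coarse_eq_zero h2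
    · rw [add_assoc, ← e1, ← e2]
      exact hn.symm
  rw [(H _ (by simp)).2]
  exact ha.inflate_iterate hbij k _

/-- If the hull has an element that is not `P`-periodic in direction `i`, it has elements that
agree with a translate of themselves on a large window, and are not `P`-periodic there, where the
translation is in direction `i` and not divisible by `M`. -/
theorem exists_almost_return [Finite 𝒜] (hbij : ϱ.IsBijective) (hL2 : ∀ h, 2 ≤ L h) {i : Fin d}
    {P : ℤ} (hP : 0 < P) {x : (Fin d → ℤ) → 𝒜} (hx : x ∈ ϱ.hull)
    (hne : shift (Pi.single i P) x ≠ x) {M : ℕ} (hM : Nat.card 𝒜 < M)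
    (hcop : Nat.Coprime M (L i)) (ρ : ℕ) :
    ∃ V ∈ ϱ.hull, ∃ D : ℤ, ¬ (M : ℤ) ∣ D ∧
      (∀ b : Fin d → ℤ, (∀ h, |b h| ≤ ρ) → V b = shift (Pi.single i D) V b) ∧
      V 0 ≠ V (Pi.single i P) := by
  have hL : ∀ h, 0 < L h := fun h => by have := hL2 h; omega
  cases nonempty_fintype 𝒜
  rw [Nat.card_eq_fintype_card] at hM
  obtain ⟨t, t', htt, heq⟩ := Fintype.exists_ne_map_eq_of_card_lt
    (fun t : Fin M => x (Pi.single i ((t : ℕ) : ℤ))) (by simpa using hM)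
  have ha := hasViolation_of_mem_hull (hL := hL) hbij hx hne (Pi.single i ((t : ℕ) : ℤ))
  obtain ⟨l, s, h1, h2, h3⟩ := ha.exists_deep hbij hL2 hP ρ
  -- `V` is centred at the deep violation in the block of `x_{t e_i}`; the equal letter at `t' e_i`
  -- produces the same block.
  let V := shift s ((ϱ.inflate hL)^[l] (shift (Pi.single i ((t : ℕ) : ℤ)) x))
  have hV' : shift (Pi.single i ((L i : ℤ) ^ l * ((t' : ℕ) - (t : ℕ) : ℤ))) V =
      shift s ((ϱ.inflate hL)^[l] (shift (Pi.single i ((t' : ℕ) : ℤ)) x)) := by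
    have : (Pi.single i ((t' : ℕ) : ℤ) : Fin d → ℤ) =
        Pi.single i ((t : ℕ) : ℤ) + Pi.single i ((t' : ℕ) - (t : ℕ) : ℤ) := by
      rw [← Pi.single_add]
      congr 1
      ring
    rw [this, shift_add, inflate_iterate_shift _ _ _ _ (Pi.single i ((t' : ℕ) - (t : ℕ) : ℤ)),
      scale_single, ← shift_add, ← shift_add, add_comm]
  refine ⟨V, ϱ.mapsTo_shift_hull _ (ϱ.inflate_iterate_mem_hull hL (ϱ.mapsTo_shift_hull _ hx) l),
    (L i : ℤ) ^ l * ((t' : ℕ) - (t : ℕ) : ℤ), fun hdvd => htt ?_, fun b hb => ?_, ?_⟩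
  · have hc : IsCoprime (M : ℤ) ((L i : ℤ) ^ l) :=
      IsCoprime.pow_right (Nat.isCoprime_iff_coprime.mpr hcop)
    have h4 := hc.dvd_of_dvd_mul_left hdvd
    have h5 := Int.eq_zero_of_abs_lt_dvd h4 (by
      have := t.2
      have := t'.2
      rw [abs_lt]
      omega)
    ext
    omega
  · rw [hV']
    simp only [V, shift_apply]
    refine inflate_iterate_apply_congr hbij ?_
    rw [h1 b hb]
    simpa [shift_apply] using heq
  · have e1 : V 0 = (ϱ.inflate hL)^[l] (fun _ => x (Pi.single i ((t : ℕ) : ℤ))) s := by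
      simp only [V, shift_apply, add_zero]
      refine inflate_iterate_apply_congr hbij ?_
      have := h1 0 (by simp)
      rw [add_zero] at this
      rw [this]
      simp
    have e2 : V (Pi.single i P) =
        (ϱ.inflate hL)^[l] (fun _ => x (Pi.single i ((t : ℕ) : ℤ))) (s + Pi.single i P) := by
      simp only [V, shift_apply]
      refine inflate_iterate_apply_congr hbij ?_
      rw [h2]
      simp
    rw [e1, e2]
    exact h3

/-- The pairs of configurations with level-`k` supertile structures whose phases differ, by a
non-zero amount, in direction `j` only. -/
def phaseShifted (ϱ : RectangularSubstitution 𝒜 L) (hL : ∀ h, 0 < L h) (j : Fin d) (k : ℕ) :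
    Set (((Fin d → ℤ) → 𝒜) × ((Fin d → ℤ) → 𝒜)) :=
  ⋃ r : (h : Fin d) → Fin (L h ^ k), ⋃ D : {D : Fin (L j ^ k) // (D : ℕ) ≠ 0},
    Set.range fun v : ((Fin d → ℤ) → 𝒜) × ((Fin d → ℤ) → 𝒜) =>
      (shift (fun h => ((r h : ℕ) : ℤ)) ((ϱ.inflate hL)^[k] v.1),
        shift ((fun h => ((r h : ℕ) : ℤ)) + Pi.single j ((D.1 : ℕ) : ℤ))
          ((ϱ.inflate hL)^[k] v.2))

theorem isClosed_phaseShifted [Finite 𝒜] [TopologicalSpace 𝒜] [DiscreteTopology 𝒜] (j : Fin d)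
    (k : ℕ) : IsClosed (ϱ.phaseShifted hL j k) :=
  isClosed_iUnion_of_finite fun _ => isClosed_iUnion_of_finite fun _ => by
    have h := ϱ.continuous_inflate_iterate hL k
    refine (isCompact_range (Continuous.prodMk ?_ ?_)).isClosed
    · exact (continuous_shift _).comp (h.comp continuous_fst)
    · exact (continuous_shift _).comp (h.comp continuous_snd)

theorem mem_phaseShifted [Finite 𝒜] [TopologicalSpace 𝒜] [DiscreteTopology 𝒜] (j : Fin d)
    (k : ℕ) {x : (Fin d → ℤ) → 𝒜} (hx : x ∈ ϱ.hull) {D : ℤ} (hD : ¬ (L j : ℤ) ^ k ∣ D) :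
    (x, shift (Pi.single j D) x) ∈ ϱ.phaseShifted hL j k := by
  obtain ⟨r, v, rfl⟩ := ϱ.exists_eq_shift_inflate_iterate hL j hx k
  have hq : (0 : ℤ) < (L j : ℤ) ^ k := pow_pos (by exact_mod_cast hL j) k
  have h1 := Int.emod_nonneg D hq.ne'
  have h2 := Int.emod_lt_of_pos D hq
  have h3 : D % (L j : ℤ) ^ k ≠ 0 := fun h0 => hD (Int.dvd_of_emod_eq_zero h0)
  -- The remainder of `D` is the phase; the quotient is absorbed as a shift of `v`.
  refine Set.mem_iUnion₂.mpr ⟨r, ⟨⟨(D % (L j : ℤ) ^ k).toNat, ?_⟩, ?_⟩,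
    (v, shift (Pi.single j (D / (L j : ℤ) ^ k)) v), Prod.ext rfl ?_⟩
  · zify
    rwa [Int.toNat_of_nonneg h1]
  · simp only
    omega
  · simp only
    rw [inflate_iterate_shift, scale_single, ← shift_add, ← shift_add, Int.toNat_of_nonneg h1,
      add_left_comm, ← Pi.single_add, Int.mul_ediv_add_emod]

theorem periodic_of_mem_phaseShifted [Finite 𝒜] (hbij : ϱ.IsBijective) (j : Fin d)
    (k : ℕ) {x : (Fin d → ℤ) → 𝒜} (hx : (x, x) ∈ ϱ.phaseShifted hL j k) :
    shift (Pi.single j ((L j : ℤ) ^ k * Nat.card (Equiv.Perm 𝒜))) x = x := by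
  obtain ⟨r, ⟨D, hD0⟩, ⟨v, v'⟩, h⟩ := Set.mem_iUnion₂.mp hx
  obtain ⟨h1, h2⟩ := Prod.mk.inj h
  simp only at h1 h2
  have hD : ¬ (L j : ℤ) ^ k ∣ ((D : ℕ) : ℤ) := fun hdvd => hD0 <|
    Nat.eq_zero_of_dvd_of_lt (by exact_mod_cast hdvd) D.2
  have hinj : Function.Injective
      (shift (A := 𝒜) (fun h => ((r h : ℕ) : ℤ) : Fin d → ℤ)) := fun y z hyz => by
    ext n
    have := congrFun hyz (-(fun h => ((r h : ℕ) : ℤ)) + n)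
    simpa using this
  have := ϱ.inflate_iterate_periodic hL hbij j k D hD v v' (hinj (by
    rw [h1, ← shift_add, add_comm, h2]))
  rw [← h1, ← shift_add, add_comm, shift_add, this]

/-- Some block must contain two neighbouring positions in direction `h`, so its side `L_h ^ k`
exceeds `1`. -/
theorem two_le_of_mem_hull {x : (Fin d → ℤ) → 𝒜} (hx : x ∈ ϱ.hull)
    (h : Fin d) : 2 ≤ L h := by
  classical
  obtain ⟨k, -, a, t, H⟩ := hx {0, Pi.single h 1}
  obtain ⟨n, hn, -⟩ := H ⟨0, by simp⟩
  obtain ⟨n', hn', -⟩ := H ⟨Pi.single h 1, by simp⟩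
  have h1 := hn h
  have h2 := hn' h
  simp only [Pi.zero_apply, Pi.single_eq_same] at h1 h2
  have h3 := (n' h).2
  by_contra hlt
  have h4 : L h ^ k ≤ 1 := (Nat.pow_le_pow_left (by omega) k).trans_eq (one_pow k)
  omega

/-! ### The limit argument and the theorem. -/

/-- No self-homeomorphism of the subshift carries the shift in direction `j` to the shift in
direction `i`, up to sign, if some prime divides `L j` but not `L i`. -/
theorem not_exists_conj [Finite 𝒜] [TopologicalSpace 𝒜] [DiscreteTopology 𝒜]
    (hbij : ϱ.IsBijective) (i j : Fin d) {p : ℕ} (hp : p.Prime) (hpj : p ∣ L j)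
    (hpi : ¬ p ∣ L i) (hne : ∀ n : Fin d → ℤ, n ≠ 0 → ∃ x ∈ ϱ.hull, shift n x ≠ x)
    (f : ϱ.subshift.carrier ≃ₜ ϱ.subshift.carrier) (ε : ℤˣ)
    (hf : ∀ (c : ℤ) x, f (shiftHomeomorph ϱ.subshift (Pi.single j c) x) =
      shiftHomeomorph ϱ.subshift (Pi.single i (ε * c)) (f x)) : False := by
  classical
  have h0j : (Pi.single j 1 : Fin d → ℤ) ≠ 0 := by simp
  have hL2 (h : Fin d) : 2 ≤ L h := by
    obtain ⟨x, hx, -⟩ := hne _ h0j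
    exact two_le_of_mem_hull hx h
  have hL (h : Fin d) : 0 < L h := by have := hL2 h; omega
  let k := Nat.card 𝒜
  have hk : Nat.card 𝒜 < p ^ k := Nat.lt_pow_self hp.one_lt
  have hpq : ((p ^ k : ℕ) : ℤ) ∣ (L j : ℤ) ^ k := by exact_mod_cast pow_dvd_pow_of_dvd hpj k
  have hcop : Nat.Coprime (p ^ k) (L i) :=
    Nat.Coprime.pow_left k ((Nat.Prime.coprime_iff_not_dvd hp).mpr hpi)
  have hcard : 0 < Nat.card (Equiv.Perm 𝒜) := Nat.card_pos
  set P : ℤ := (L j : ℤ) ^ k * Nat.card (Equiv.Perm 𝒜) with hPdef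
  have hP : 0 < P := mul_pos (pow_pos (by exact_mod_cast hL j) k) (by exact_mod_cast hcard)
  obtain ⟨x, hx, hxP⟩ := hne (Pi.single i P) (by simpa using hP.ne')
  choose V hV D hD hVD hVP using exists_almost_return hbij hL2 hP hx hxP hk hcop
  have : CompactSpace ϱ.subshift.carrier :=
    isCompact_iff_compactSpace.mp ϱ.isClosed_hull.isCompact
  let 𝒰 : Ultrafilter ℕ := Filter.hyperfilter ℕ
  let y : ℕ → ϱ.subshift.carrier := fun ρ => ⟨V ρ, hV ρ⟩
  let y' : ℕ → ϱ.subshift.carrier := fun ρ =>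
    shiftHomeomorph ϱ.subshift (Pi.single i (D ρ)) (y ρ)
  obtain ⟨z, hz⟩ : ∃ z, Filter.Tendsto y 𝒰 (nhds z) := by
    obtain ⟨z, -, hz⟩ := isCompact_univ.ultrafilter_le_nhds (𝒰.map y) (by simp)
    exact ⟨z, hz⟩
  -- Each coordinate lies in all sufficiently large windows, where `y` and `y'` agree.
  have hz' : Filter.Tendsto y' 𝒰 (nhds z) := by
    rw [tendsto_subtype_rng, tendsto_pi_nhds] at hz ⊢
    intro b
    refine (hz b).congr' (Filter.Eventually.filter_mono Nat.hyperfilter_le_atTop ?_)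
    filter_upwards [Filter.eventually_ge_atTop (∑ h, (b h).natAbs)] with ρ hρ
    refine hVD ρ b fun h => ?_
    have := Finset.single_le_sum (f := fun h => (b h).natAbs) (fun _ _ => Nat.zero_le _)
      (Finset.mem_univ h)
    rw [Int.abs_eq_natAbs]
    exact_mod_cast this.trans hρ
  have hfs (c : ℤ) (u) : f.symm (shiftHomeomorph ϱ.subshift (Pi.single i c) u) =
      shiftHomeomorph ϱ.subshift (Pi.single j (ε * c)) (f.symm u) := by
    rw [f.symm_apply_eq, hf, f.apply_symm_apply, ← mul_assoc, ← Units.val_mul,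
      Int.units_mul_self, Units.val_one, one_mul]
  have hmem : ((f.symm z).1, (f.symm z).1) ∈ ϱ.phaseShifted hL j k := by
    have h1 := (continuous_subtype_val.comp f.symm.continuous).continuousAt.tendsto.comp hz
    have h2 := (continuous_subtype_val.comp f.symm.continuous).continuousAt.tendsto.comp hz'
    refine (isClosed_phaseShifted j k).mem_of_tendsto (h1.prodMk_nhds h2)
      (Filter.Eventually.of_forall fun ρ => ?_)
    simp only [Function.comp_apply, y', hfs]
    refine mem_phaseShifted j k (f.symm (y ρ)).2 fun hdvd => hD ρ (hpq.trans ?_)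
    exact (Int.isUnit_iff.mp ε.isUnit).elim (fun h => by simpa [h] using hdvd)
      fun h => by simpa [h] using hdvd
  have hper : shiftHomeomorph ϱ.subshift (Pi.single j P) (f.symm z) = f.symm z :=
    Subtype.ext (periodic_of_mem_phaseShifted hbij j k hmem)
  have hper' : shift (Pi.single i (ε * P)) z.1 = z.1 := by
    have := hf P (f.symm z)
    rw [hper, f.apply_symm_apply] at this
    exact congrArg Subtype.val this.symm
  -- The alphabet is discrete, so inequality of two coordinates is a closed condition and passes to
  -- the limit.
  have hzP : z.1 0 ≠ z.1 (Pi.single i P) := by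
    have hcl : IsClosed {u : ϱ.subshift.carrier | u.1 0 ≠ u.1 (Pi.single i P)} :=
      (isClosed_discrete {a : 𝒜 × 𝒜 | a.1 ≠ a.2}).preimage
        (f := fun u : ϱ.subshift.carrier => (u.1 0, u.1 (Pi.single i P))) 
        (((continuous_apply _).comp continuous_subtype_val).prodMk
          ((continuous_apply _).comp continuous_subtype_val))
    exact hcl.mem_of_tendsto hz (Filter.Eventually.of_forall hVP)
  rcases Int.units_eq_one_or ε with rfl | rfl
  · have := congrFun hper' 0
    simp at this
    exact hzP this.symm
  · have := congrFun hper' (Pi.single i P)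
    rw [shift_apply, ← Pi.single_add] at this
    simp at this
    exact hzP this

end RectangularSubstitution

theorem mainTheorem6 {d : ℕ} {𝒜 : Type*} [Finite 𝒜] [TopologicalSpace 𝒜] [DiscreteTopology 𝒜]
    (L : Fin d → ℕ) (ϱ : RectangularSubstitution 𝒜 L) (hbij : ϱ.IsBijective)
    (hfaithful : IsFaithfulShift ϱ.subshift)
    (i j : Fin d) (hp : ∃ p : ℕ, p.Prime ∧ p ∣ L j ∧ ¬ p ∣ L i)
    (A : GL (Fin d) ℤ) (hA : A ∈ hyperoctahedralGroup d)
    (f : ϱ.subshift.carrier ≃ₜ ϱ.subshift.carrier)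
    (hf : f ∈ extendedSymmetryGroup ϱ.subshift) (hfA : IsUnderlyingMatrix f A) :
    A i j = 0 ∧ A j i = 0 := by
  obtain ⟨p, hp, hpj, hpi⟩ := hp
  obtain ⟨π, ε, hA⟩ := hA
  have hne (n : Fin d → ℤ) (hn : n ≠ 0) : ∃ x ∈ ϱ.hull, shift n x ≠ x := by
    by_contra! H
    refine hn (Multiplicative.ofAdd.injective (hfaithful (?_ :
      shiftAction ϱ.subshift (Multiplicative.ofAdd n) = shiftAction ϱ.subshift 1)))
    rw [map_one]
    ext1 x
    exact Subtype.ext (H x.1 x.2)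
  have hconj (n : Fin d → ℤ) (x) : f (shiftHomeomorph ϱ.subshift n x) =
      shiftHomeomorph ϱ.subshift ((A : Matrix (Fin d) (Fin d) ℤ).mulVec n) (f x) := by
    rw [← hfA n]
    simp
  have hcol (a b : Fin d) (hab : A a b ≠ 0) (c : ℤ) :
      (A : Matrix (Fin d) (Fin d) ℤ).mulVec (Pi.single b c) = Pi.single a (ε b * c) := by
    have hπ : a = π b := by
      by_contra h
      exact hab (by rw [hA, if_neg h])
    ext h
    rw [Matrix.mulVec_single, hπ]
    by_cases hh : h = π b <;> simp [hA, hh, mul_comm]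
  constructor
  · by_contra hij
    exact RectangularSubstitution.not_exists_conj hbij i j hp hpj hpi hne f (ε j)
      fun c x => by rw [hconj, hcol i j hij]
  -- Here `A` maps `e_i` to `±e_j`, so the inverse carries direction `j` to direction `i`, with the
  -- same sign.
  · by_contra hji
    refine RectangularSubstitution.not_exists_conj hbij i j hp hpj hpi hne f.symm (ε i)
      fun c x => ?_
    rw [f.symm_apply_eq, hconj, hcol j i hji, f.apply_symm_apply, ← mul_assoc, ← Units.val_mul,
      Int.units_mul_self, Units.val_one, one_mul]
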